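/- Let $K$ be a field of characteristic zero, let $n,d\ge 1$ be integers and let $S=K[X_1,\dots,X_n]$. For $a\in\mathbb{N}^n$ write $X^a=X_1^{a_1}\cdots X_n^{a_n}$ (with $0\in\mathbb{N}$), let $\mathbb{N}^n_d=\{a\in\mathbb{N}^n: a_1+\dots+a_n=d\}$, and let $e_1,\dots,e_n$ be the standard basis of $\mathbb{Z}^n$. For $a,b\in\mathbb{N}^n_d$ write $a\ge_{\mathrm{Bor}} b$ if $a-b=\sum_{j=1}^{n-1}\alpha_j(e_j-e_{j+1})$ for some $\alpha_1,\dots,\alpha_{n-1}\in\mathbb{N}$. A set $B\subset\mathbb{N}^n_d$ is a Borel set if $a\in B$, $b\in\mathbb{N}^n_d$ and $b\ge_{\mathrm{Bor}}a$ imply $b\in B$. A binomial system of degree $d$ in $n$ indeterminates is a triple $(A,C,\rho)$ with $A,C\subset\mathbb{N}^n_d$ and $\rho\in\mathbb{Z}^n$ such that (i) $C+\rho\subset\mathbb{N}^n_d$, (ii) $A\cap C=A\cap(C+\rho)=C\cap(C+\rho)=\emptyset$, and (iii) $A\cup C$ and $A\cup(C+\rho)$ are Borel sets. Put $m(\rho)=\max(\{i:\rho_i\ne0\}\cup\{1\})$.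 The system is good if $b_i=c_i$ for all $b,c\in C$ and all $1\le i<m(\rho)$. Let $$F(A,C,\rho)=\bigl(\{X^a: a\in A\}\cup\{X^c-X^{c+\rho}: c\in C\}\bigr)\subset S.$$ A term order $\tau$ on the monomials of $S$ is admissible if $X_1>\dots>X_n$ and $\deg u>\deg v$ implies $u>v$ for all monomials $u,v$. For an ideal $\mathfrak a\subset S$ let $\mathrm{in}_\tau\,\mathfrak a$ be the ideal generated by the leading terms of the elements of $\mathfrak a$. A matrix $g\in\mathrm{GL}(n,K)$ acts on $S$ by the $K$-algebra automorphism $X_j\mapsto\sum_{i=1}^n g_{ij}X_i$. The generic initial ideal $\mathrm{Gin}_\tau\,\mathfrak a$ is the unique ideal $\mathfrak b$ for which there is a non-empty Zariski open set $U\subset\mathrm{GL}(n,K)$ with $\mathrm{in}_\tau\,g(\mathfrak a)=\mathfrak b$ for all $g\in U$. **Proposition.** Let $(A,C,\rho)$ be a good binomial system of degree $d$ in $n$ indeterminates and let $\tau$ be an admissible term order. Then the generic initial ideal of $F(A,C,\rho)$ with respect to $\tau$ exists and is unique, and $$\mathrm{Gin}_\tau F(A,C,\rho)=\mathrm{in}_\tau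 F(A,C,\rho).$$ -/

import Mathlib

open MvPolynomial
open scoped MonomialOrder

namespace BinomialGin

noncomputable section

/-! Exponent vectors `a ∈ ℕⁿ` are elements of `Fin n →₀ ℕ`; the variable `X_i` of the literature
(`1 ≤ i ≤ n`) is `X` of the `i`-th element of `Fin n`. -/

/-- `ℕ_d^n`: the exponent vectors of total degree `d`. -/
def degreeSet (n d : ℕ) : Set (Fin n →₀ ℕ) := {a | a.degree = d}

/-- An exponent vector regarded as an element of `ℤⁿ`. -/
def toInt {n : ℕ} (a : Fin n →₀ ℕ) : Fin n → ℤ := fun i => (a i : ℤ)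

/-- The Borel order `a ≥_Bor b`: the difference `a - b` is a combination of the vectors
`e_j - e_{j+1}` (`1 ≤ j < n`) with coefficients in `ℕ`. -/
def BorelGE {n : ℕ} (a b : Fin n →₀ ℕ) : Prop :=
  ∃ α : Fin (n - 1) → ℕ,
    toInt a - toInt b =
      ∑ j : Fin (n - 1),
        α j • (Pi.single (⟨j.1, by omega⟩ : Fin n) (1 : ℤ) -
          Pi.single (⟨j.1 + 1, by omega⟩ : Fin n) (1 : ℤ))

/-- Borel sets in `ℕ_d^n`: subsets that are closed upwards for the Borel order. -/
def IsBorelSet {n : ℕ} (d : ℕ) (A : Set (Fin n →₀ ℕ)) : Prop :=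
  A ⊆ degreeSet n d ∧
    ∀ a ∈ degreeSet n d, ∀ b ∈ degreeSet n d, a ∈ A → BorelGE b a → b ∈ A

/-- The elements of `ℕⁿ` of the form `c + ρ` with `c ∈ C`. -/
def translateSet {n : ℕ} (C : Set (Fin n →₀ ℕ)) (ρ : Fin n → ℤ) : Set (Fin n →₀ ℕ) :=
  {e | ∃ c ∈ C, toInt e = toInt c + ρ}

/-- Binomial systems `(A, C, ρ)` of degree `d` in `n` indeterminates. -/
structure IsBinomialSystem {n : ℕ} (d : ℕ) (A C : Set (Fin n →₀ ℕ)) (ρ : Fin n → ℤ) : Prop where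
  left_subset : A ⊆ degreeSet n d
  right_subset : C ⊆ degreeSet n d
  /-- `C + ρ ⊆ ℕ_d^n` -/
  translate_mem : ∀ c ∈ C, ∃ e ∈ degreeSet n d, toInt e = toInt c + ρ
  inter_right : A ∩ C = ∅
  inter_translate : A ∩ translateSet C ρ = ∅
  right_inter_translate : C ∩ translateSet C ρ = ∅
  borel_union : IsBorelSet d (A ∪ C)
  borel_union_translate : IsBorelSet d (A ∪ translateSet C ρ)

/-- `m(ρ)`: the largest index `i` with `ρ_i ≠ 0`, and the first index if `ρ = 0`. -/
def maxIndex {n : ℕ} [NeZero n] (ρ : Fin n → ℤ) : Fin n :=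
  (insert 0 (Finset.univ.filter fun i => ρ i ≠ 0)).max' (Finset.insert_nonempty _ _)

/-- Good binomial systems: any two elements of `C` agree in all indices below `m(ρ)`. -/
def IsGoodBinomialSystem {n : ℕ} [NeZero n] (d : ℕ) (A C : Set (Fin n →₀ ℕ)) (ρ : Fin n → ℤ) :
    Prop :=
  IsBinomialSystem d A C ρ ∧ ∀ b ∈ C, ∀ c ∈ C, ∀ i, i < maxIndex ρ → b i = c i

/-- `X^A`: the monomials with exponent in `A`. -/
def monomials {n : ℕ} (K : Type*) [Field K] (A : Set (Fin n →₀ ℕ)) :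
    Set (MvPolynomial (Fin n) K) :=
  {f | ∃ a ∈ A, f = monomial a 1}

/-- `Bin(C, ρ)`: the binomials `X^c - X^(c+ρ)` with `c ∈ C`. -/
def binomials {n : ℕ} (K : Type*) [Field K] (C : Set (Fin n →₀ ℕ)) (ρ : Fin n → ℤ) :
    Set (MvPolynomial (Fin n) K) :=
  {f | ∃ c ∈ C, ∃ e : Fin n →₀ ℕ, toInt e = toInt c + ρ ∧ f = monomial c 1 - monomial e 1}

/-- `F(A, C, ρ)`: the ideal generated by `X^A` and `Bin(C, ρ)`. -/
def binomialIdeal {n : ℕ} (K : Type*) [Field K] (A C : Set (Fin n →₀ ℕ)) (ρ : Fin n → ℤ) :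
    Ideal (MvPolynomial (Fin n) K) :=
  Ideal.span (monomials K A ∪ binomials K C ρ)

/-- Admissible term orders: `X_1 > ⋯ > X_n`, and monomials of larger degree are larger. -/
def IsAdmissible {n : ℕ} (τ : MonomialOrder (Fin n)) : Prop :=
  (∀ i j : Fin n, i < j → Finsupp.single j 1 ≺[τ] Finsupp.single i 1) ∧
    ∀ u v : Fin n →₀ ℕ, v.degree < u.degree → v ≺[τ] u

/-- `in_τ 𝔞`: the ideal generated by the leading terms of all the elements of `𝔞`. -/
def initialIdeal {n : ℕ} {K : Type*} [Field K] (τ : MonomialOrder (Fin n))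
    (𝔞 : Ideal (MvPolynomial (Fin n) K)) : Ideal (MvPolynomial (Fin n) K) :=
  Ideal.span (τ.leadingTerm '' (𝔞 : Set (MvPolynomial (Fin n) K)))

/-- The `K`-algebra homomorphism given by a matrix `g`: `X_j ↦ ∑ i, g_ij X_i`. -/
def linearSubst {n : ℕ} {K : Type*} [Field K] (g : Matrix (Fin n) (Fin n) K) :
    MvPolynomial (Fin n) K →ₐ[K] MvPolynomial (Fin n) K :=
  aeval fun j => ∑ i, C (g i j) * X i

/-- Zariski open subsets of `GL(n, K)`: complements in `GL(n, K)` of the common zero set of some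
polynomials in the matrix entries. -/
def IsZariskiOpen {n : ℕ} {K : Type*} [Field K] (U : Set (GL (Fin n) K)) : Prop :=
  ∃ P : Set (MvPolynomial (Fin n × Fin n) K),
    U = {g : GL (Fin n) K | ∃ p ∈ P, eval (fun ij => (g : Matrix (Fin n) (Fin n) K) ij.1 ij.2) p ≠ 0}

/-- `𝔟` is a generic initial ideal of `𝔞`: `in_τ g(𝔞) = 𝔟` for all `g` in some non-empty Zariski
open subset of `GL(n, K)`. Here `g(𝔞)` is the image of `𝔞` under the automorphism `g`. -/
def IsGenericInitialIdeal {n : ℕ} {K : Type*} [Field K] (τ : MonomialOrder (Fin n))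
    (𝔞 𝔟 : Ideal (MvPolynomial (Fin n) K)) : Prop :=
  ∃ U : Set (GL (Fin n) K), IsZariskiOpen U ∧ U.Nonempty ∧
    ∀ g ∈ U, initialIdeal τ (𝔞.map (linearSubst (g : Matrix (Fin n) (Fin n) K))) = 𝔟

open Classical in
/-- `Gin_τ 𝔞`: the generic initial ideal of `𝔞` (the zero ideal should none exist). -/
def gin {n : ℕ} {K : Type*} [Field K] (τ : MonomialOrder (Fin n))
    (𝔞 : Ideal (MvPolynomial (Fin n) K)) : Ideal (MvPolynomial (Fin n) K) :=
  if h : ∃ 𝔟, IsGenericInitialIdeal τ 𝔞 𝔟 then h.choose else ⊥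

end

end BinomialGin

/-! The ideal `F` of a good binomial system is fixed by every upper unitriangular substitution, and
this alone yields the result. If the proper leading principal minors of `g` are nonzero, then `g * V
= L` with `V` upper unitriangular and `L` lower triangular, so `g(F) = L(F)`. A lower triangular `L`
only adds smaller variables to a multiple of each variable, hence preserves initial ideals
(`initialIdeal_map_linearSubst_of_lower`). Uniqueness holds because non-empty open sets meet when
`K` is infinite.

For the invariance, an upper triangular `V` sends `X^c` to a combination of monomials above `c` in
the Borel order. Thus `X^A` spans an invariant part, since `A` is the intersection of the two Borel
sets. A binomial `X^c - X^e` is split at `m(ρ)` into heads `s`, `s'` and a common tail `t`. Moving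
only the tail gives differences of monomials that lie in `F`. Moving a head strictly leads into `A`,
because goodness forbids any change below `m(ρ)` inside `C` or `C + ρ`
(`mem_left_of_strictly_dominates`). -/

namespace BinomialGin

open Matrix

/-! ### Linear substitutions and their composition. -/

section LinearSubst

variable {n : ℕ} {K : Type*} [Field K]

lemma exponent_induction {p : (Fin n →₀ ℕ) → Prop} (zero : p 0)
    (add : ∀ a b, p a → p b → p (a + b)) (single : ∀ i, p (Finsupp.single i 1))
    (c : Fin n →₀ ℕ) : p c := by
  induction c using Finsupp.induction_linear with
  | zero => exact zero
  | add f g hf hg => exact add f g hf hg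
  | single i k =>
    induction k with
    | zero => simpa using zero
    | succ k ih => rw [Finsupp.single_add]; exact add _ _ ih (single i)

lemma monomial_one_add (a b : Fin n →₀ ℕ) :
    (monomial (a + b) 1 : MvPolynomial (Fin n) K) = monomial a 1 * monomial b 1 := by
  rw [monomial_mul, one_mul]

lemma linearSubst_X (g : Matrix (Fin n) (Fin n) K) (j : Fin n) :
    linearSubst g (X j) = ∑ i, MvPolynomial.C (g i j) * X i := by
  simp [linearSubst]

lemma linearSubst_mul_apply (g h : Matrix (Fin n) (Fin n) K) (f : MvPolynomial (Fin n) K) :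
    linearSubst (g * h) f = linearSubst g (linearSubst h f) := by
  rw [← AlgHom.comp_apply]
  congr 1
  refine MvPolynomial.algHom_ext fun j => ?_
  simp only [AlgHom.comp_apply, linearSubst_X, map_sum, map_mul, algHom_C, Matrix.mul_apply,
    Finset.sum_mul, Finset.mul_sum, MvPolynomial.algebraMap_eq]
  rw [Finset.sum_comm]
  refine Finset.sum_congr rfl fun k _ => Finset.sum_congr rfl fun i _ => ?_
  ring

lemma linearSubst_one_apply (f : MvPolynomial (Fin n) K) :
    linearSubst (1 : Matrix (Fin n) (Fin n) K) f = f := by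
  have : linearSubst (1 : Matrix (Fin n) (Fin n) K) = AlgHom.id K _ := by
    refine MvPolynomial.algHom_ext fun j => ?_
    rw [linearSubst_X, AlgHom.id_apply, Finset.sum_eq_single j]
    · simp
    · intro i _ hij
      simp [Matrix.one_apply_ne hij]
    · simp
  rw [this, AlgHom.id_apply]

lemma map_linearSubst_mul (g h : Matrix (Fin n) (Fin n) K) (I : Ideal (MvPolynomial (Fin n) K)) :
    I.map (linearSubst (g * h)) = (I.map (linearSubst h)).map (linearSubst g) := by
  have : linearSubst (g * h) = (linearSubst g).comp (linearSubst h) :=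
    AlgHom.ext (linearSubst_mul_apply g h)
  rw [this, ← Ideal.map_mapₐ]

lemma linearSubst_surjective {g : Matrix (Fin n) (Fin n) K} (hg : IsUnit g.det) :
    Function.Surjective (linearSubst g) := fun f =>
  ⟨linearSubst g⁻¹ f, by
    rw [← linearSubst_mul_apply, Matrix.mul_nonsing_inv _ hg, linearSubst_one_apply]⟩

lemma coeff_sum_C_mul_X (a : Fin n → K) (b : Fin n →₀ ℕ) :
    coeff b (∑ i, MvPolynomial.C (a i) * X i) = ∑ i, if Finsupp.single i 1 = b then a i else 0 := by
  simp [coeff_sum, coeff_C_mul, coeff_X]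

end LinearSubst

/-! ### Lower triangular substitutions and leading terms. -/

section Lower

variable {n : ℕ} {K : Type*} [Field K] (τ : MonomialOrder (Fin n))

lemma degree_eq_of_support_le {f : MvPolynomial (Fin n) K} {c : Fin n →₀ ℕ}
    (hle : ∀ b ∈ f.support, b ≼[τ] c) (hc : coeff c f ≠ 0) : τ.degree f = c :=
  τ.toSyn.injective <|
    le_antisymm (τ.degree_le_iff.2 hle) (τ.le_degree (mem_support_iff.2 hc))

/-- Only variables `X i` with `j ≤ i` occur in the image of `X j`, and `X j` is the largest of them.
-/
lemma leadingTerm_linearSubst_X (hτ : IsAdmissible τ) {L : Matrix (Fin n) (Fin n) K}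
    (hL : ∀ i j, i < j → L i j = 0) (hd : ∀ i, L i i ≠ 0) (j : Fin n) :
    τ.leadingTerm (linearSubst L (X j)) = monomial (Finsupp.single j 1) (L j j) := by
  have hcoeff : ∀ i, coeff (Finsupp.single i 1) (linearSubst L (X j)) = L i j := fun i => by
    rw [linearSubst_X, coeff_sum_C_mul_X]
    simp [Finsupp.single_left_inj]
  have hdeg : τ.degree (linearSubst L (X j)) = Finsupp.single j 1 := by
    refine degree_eq_of_support_le τ (fun b hb => ?_) (by rw [hcoeff]; exact hd j)
    rw [mem_support_iff, linearSubst_X, coeff_sum_C_mul_X] at hb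
    obtain ⟨i, -, hi⟩ := Finset.exists_ne_zero_of_sum_ne_zero hb
    rw [ne_eq, ite_eq_right_iff, Classical.not_imp] at hi
    obtain ⟨rfl, hi⟩ := hi
    rcases lt_trichotomy i j with h | rfl | h
    · exact absurd (hL i j h) hi
    · exact le_rfl
    · exact (hτ.1 j i h).le
  rw [MonomialOrder.leadingTerm, MonomialOrder.leadingCoeff, hdeg, hcoeff]

lemma exists_leadingTerm_linearSubst_monomial (hτ : IsAdmissible τ)
    {L : Matrix (Fin n) (Fin n) K}
    (hL : ∀ i j, i < j → L i j = 0) (hd : ∀ i, L i i ≠ 0) (c : Fin n →₀ ℕ) :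
    ∃ u : K, u ≠ 0 ∧ τ.leadingTerm (linearSubst L (monomial c 1)) = monomial c u := by
  induction c using exponent_induction with
  | zero => exact ⟨1, one_ne_zero, by rw [show monomial 0 (1 : K) = 1 from rfl, map_one]; simp [MonomialOrder.leadingTerm]⟩
  | add a b ha hb =>
    obtain ⟨u, hu, ha⟩ := ha
    obtain ⟨v, hv, hb⟩ := hb
    exact ⟨u * v, mul_ne_zero hu hv, by
      rw [monomial_one_add, map_mul, τ.leadingTerm_mul, ha, hb, monomial_mul]⟩
  | single i => exact ⟨L i i, hd i, leadingTerm_linearSubst_X τ hτ hL hd i⟩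

/-- Each monomial keeps its exponent as leading exponent, so the images of the smaller terms of `f`
cannot reach, let alone cancel, the leading one. -/
lemma exists_leadingTerm_linearSubst (hτ : IsAdmissible τ) {L : Matrix (Fin n) (Fin n) K}
    (hL : ∀ i j, i < j → L i j = 0) (hd : ∀ i, L i i ≠ 0) (f : MvPolynomial (Fin n) K) :
    ∃ u : K, u ≠ 0 ∧
      τ.leadingTerm (linearSubst L f) = MvPolynomial.C u * τ.leadingTerm f := by
  rcases eq_or_ne f 0 with rfl | hf
  · exact ⟨1, one_ne_zero, by simp⟩
  choose u hu hlt using exists_leadingTerm_linearSubst_monomial τ hτ hL hd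
  have hdeg : ∀ c, τ.degree (linearSubst L (monomial c 1)) = c := fun c => by
    classical
    rw [← τ.degree_leadingTerm, hlt, τ.degree_monomial, if_neg (hu c)]
  have hlc : ∀ c, coeff c (linearSubst L (monomial c 1)) = u c := fun c => by
    have := congrArg τ.leadingCoeff (hlt c)
    rwa [τ.leadingCoeff_leadingTerm, τ.leadingCoeff_monomial, MonomialOrder.leadingCoeff,
      hdeg] at this
  have hexp : linearSubst L f =
      ∑ c ∈ f.support, MvPolynomial.C (coeff c f) * linearSubst L (monomial c 1) := by
    conv_lhs => rw [f.as_sum, map_sum]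
    refine Finset.sum_congr rfl fun c _ => ?_
    rw [← mul_one (coeff c f), ← C_mul_monomial, map_mul, algHom_C, mul_one]
    rfl
  have hle : ∀ b ∈ (linearSubst L f).support, b ≼[τ] τ.degree f := by
    intro b hb
    rw [mem_support_iff, hexp, coeff_sum] at hb
    obtain ⟨c, hc, hcb⟩ := Finset.exists_ne_zero_of_sum_ne_zero hb
    rw [coeff_C_mul] at hcb
    have := τ.le_degree (mem_support_iff.2 (right_ne_zero_of_mul hcb))
    rw [hdeg] at this
    exact this.trans (τ.le_degree hc)
  have hcoeff : coeff (τ.degree f) (linearSubst L f) = u (τ.degree f) * τ.leadingCoeff f := by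
    rw [hexp, coeff_sum, Finset.sum_eq_single (τ.degree f), coeff_C_mul, hlc, mul_comm]
    · rfl
    · intro c hc hne
      rw [coeff_C_mul, τ.coeff_eq_zero_of_lt (f := linearSubst L _), mul_zero]
      rw [hdeg]
      exact lt_of_le_of_ne (τ.le_degree hc) fun h => hne (τ.toSyn.injective h)
    · intro h
      exact absurd (τ.degree_mem_support hf) h
  have hD : τ.degree (linearSubst L f) = τ.degree f :=
    degree_eq_of_support_le τ hle
      (by rw [hcoeff]; exact mul_ne_zero (hu _) (τ.leadingCoeff_ne_zero_iff.2 hf))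
  refine ⟨u (τ.degree f), hu _, ?_⟩
  rw [MonomialOrder.leadingTerm, MonomialOrder.leadingTerm, C_mul_monomial, hD,
    MonomialOrder.leadingCoeff, hD, hcoeff]

/-- Lower triangular changes of coordinates do not change initial ideals. -/
lemma initialIdeal_map_linearSubst_of_lower (hτ : IsAdmissible τ)
    {L : Matrix (Fin n) (Fin n) K} (hL : ∀ i j, i < j → L i j = 0) (hd : ∀ i, L i i ≠ 0)
    (I : Ideal (MvPolynomial (Fin n) K)) :
    initialIdeal τ (I.map (linearSubst L)) = initialIdeal τ I := by
  have hdet : IsUnit L.det := by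
    rw [Matrix.det_of_isLowerTriangular L fun i j h => hL i j h]
    exact (Finset.prod_ne_zero_iff.2 fun i _ => hd i).isUnit
  apply le_antisymm
  · refine Ideal.span_le.2 ?_
    rintro _ ⟨f, hf, rfl⟩
    obtain ⟨f, hfI, rfl⟩ :=
      (Ideal.mem_map_iff_of_surjective _ (linearSubst_surjective hdet)).1 hf
    obtain ⟨u, -, h⟩ := exists_leadingTerm_linearSubst τ hτ hL hd f
    rw [h]
    exact Ideal.mul_mem_left _ _ (Ideal.subset_span ⟨f, hfI, rfl⟩)
  · refine Ideal.span_le.2 ?_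
    rintro _ ⟨f, hf, rfl⟩
    obtain ⟨u, hu, h⟩ := exists_leadingTerm_linearSubst τ hτ hL hd f
    have : τ.leadingTerm f = MvPolynomial.C u⁻¹ * τ.leadingTerm (linearSubst L f) := by
      rw [h, ← mul_assoc, ← MvPolynomial.C_mul, inv_mul_cancel₀ hu, MvPolynomial.C_1, one_mul]
    rw [this]
    exact Ideal.mul_mem_left _ _ (Ideal.subset_span ⟨_, Ideal.mem_map_of_mem (linearSubst L) hf, rfl⟩)

end Lower

/-! ### Triangular factorization of generic matrices and generic initial ideals. -/

section Zariski

variable {n : ℕ} {K : Type*} [Field K]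

/-- The product of the proper leading principal minors of the generic matrix. -/
noncomputable def minorProduct (n : ℕ) (K : Type*) [Field K] : MvPolynomial (Fin n × Fin n) K :=
  ∏ j : Fin n, ((mvPolynomialX (Fin n) (Fin n) K).toSquareBlockProp (· < j)).det

lemma eval_minorProduct (g : Matrix (Fin n) (Fin n) K) :
    eval (fun ij => g ij.1 ij.2) (minorProduct n K) =
      ∏ j : Fin n, (g.toSquareBlockProp (· < j)).det := by
  rw [minorProduct, map_prod]
  refine Finset.prod_congr rfl fun j _ => ?_
  rw [RingHom.map_det]
  congr 1
  ext a b
  simp [Matrix.toSquareBlockProp]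

/-- A matrix with nonvanishing leading principal minors becomes lower triangular after
multiplication by an upper unitriangular matrix. -/
lemma exists_unitriangular_mul_lower (g : Matrix (Fin n) (Fin n) K)
    (hg : ∀ j : Fin n, (g.toSquareBlockProp (· < j)).det ≠ 0) :
    ∃ V : Matrix (Fin n) (Fin n) K, V.IsUpperTriangular ∧ (∀ i, V i i = 1) ∧
      ∀ i j, i < j → (g * V) i j = 0 := by
  have hy : ∀ j : Fin n, ∃ y : {i // i < j} → K,
      (g.toSquareBlockProp (· < j)).mulVec y = fun i => - g i.1 j := fun j =>
    ⟨(g.toSquareBlockProp (· < j))⁻¹.mulVec fun i => - g i.1 j, by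
      rw [Matrix.mulVec_mulVec, Matrix.mul_nonsing_inv _ (hg j).isUnit, Matrix.one_mulVec]⟩
  choose y hy using hy
  -- Column `j` of `V` is `y j` above the diagonal and `1` on it; the linear system for `y j` makes
  -- column `j` of `g * V` vanish above the diagonal.
  refine ⟨Matrix.of fun i j => if h : i < j then y j ⟨i, h⟩ else if i = j then 1 else 0, ?_, ?_, ?_⟩
  · intro i j (hij : j < i)
    simp [hij.not_gt, hij.ne']
  · intro i
    simp
  · intro i j hij
    have h := congrFun (hy j) ⟨i, hij⟩
    simp only [Matrix.mulVec, dotProduct, Matrix.toSquareBlockProp] at h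
    simp only [Matrix.mul_apply, Matrix.of_apply]
    rw [← Finset.sum_filter_add_sum_filter_not _ (· < j)]
    have h1 : ∑ k with k < j, g i k * (if h : k < j then y j ⟨k, h⟩ else if k = j then 1 else 0)
        = - g i j := by
      rw [← h, ← Finset.sum_subtype_eq_sum_filter, Finset.subtype_univ]
      exact Finset.sum_congr rfl fun k _ => by rw [dif_pos k.2]; rfl
    have h2 : ∑ k with ¬ k < j, g i k * (if h : k < j then y j ⟨k, h⟩ else if k = j then 1 else 0)
        = g i j := by
      rw [Finset.sum_eq_single j]
      · simp
      · intro k hk hne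
        simp [(Finset.mem_filter.1 hk).2, hne]
      · simp
    rw [h1, h2, neg_add_cancel]

lemma IsGenericInitialIdeal.unique [Infinite K] {τ : MonomialOrder (Fin n)}
    {I b b' : Ideal (MvPolynomial (Fin n) K)} (h : IsGenericInitialIdeal τ I b)
    (h' : IsGenericInitialIdeal τ I b') : b = b' := by
  obtain ⟨_, ⟨P, rfl⟩, ⟨g, p, hp, hg⟩, h⟩ := h
  obtain ⟨_, ⟨P', rfl⟩, ⟨g', p', hp', hg'⟩, h'⟩ := h'
  -- A point where this product is nonzero is an invertible matrix in both open sets; it exists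
  -- because `K` is infinite.
  have hne : p * p' * (mvPolynomialX (Fin n) (Fin n) K).det ≠ 0 := by
    refine mul_ne_zero (mul_ne_zero ?_ ?_) (det_mvPolynomialX_ne_zero (Fin n) K)
    · rintro rfl
      simp at hg
    · rintro rfl
      simp at hg'
  obtain ⟨x, hx⟩ : ∃ x, eval x (p * p' * (mvPolynomialX (Fin n) (Fin n) K).det) ≠ 0 := by
    by_contra! hx
    exact hne (MvPolynomial.funext fun x => by rw [hx, map_zero])
  rw [map_mul, map_mul] at hx
  let M : Matrix (Fin n) (Fin n) K := Matrix.of fun i j => x (i, j)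
  have hM : M.det ≠ 0 := by
    have := right_ne_zero_of_mul hx
    rw [RingHom.map_det] at this
    convert this
    ext i j
    simp [M]
  let G : GL (Fin n) K := Matrix.GeneralLinearGroup.mkOfDetNeZero M hM
  have hx1 := left_ne_zero_of_mul hx
  rw [← h G ⟨p, hp, left_ne_zero_of_mul hx1⟩, ← h' G ⟨p', hp', right_ne_zero_of_mul hx1⟩]

/-- An ideal fixed by the upper unitriangular group has its initial ideal as generic initial
ideal. -/
lemma isGenericInitialIdeal_of_unitriangular_fixed {τ : MonomialOrder (Fin n)}
    (hτ : IsAdmissible τ) {I : Ideal (MvPolynomial (Fin n) K)}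
    (hI : ∀ V : Matrix (Fin n) (Fin n) K, V.IsUpperTriangular → (∀ i, V i i = 1) →
      I.map (linearSubst V) = I) :
    IsGenericInitialIdeal τ I (initialIdeal τ I) := by
  refine ⟨_, ⟨{minorProduct n K}, rfl⟩, ⟨1, _, rfl, ?_⟩, ?_⟩
  · rw [eval_minorProduct]
    refine Finset.prod_ne_zero_iff.2 fun j _ => ?_
    have : (((1 : GL (Fin n) K) : Matrix (Fin n) (Fin n) K).toSquareBlockProp (· < j)) = 1 := by
      ext a b
      simp [Matrix.toSquareBlockProp, Matrix.one_apply, Subtype.ext_iff]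
    rw [this, Matrix.det_one]
    exact one_ne_zero
  · rintro g ⟨_, rfl, hg⟩
    rw [eval_minorProduct, Finset.prod_ne_zero_iff] at hg
    obtain ⟨V, hV, hV1, hL⟩ := exists_unitriangular_mul_lower _ fun j => hg j (Finset.mem_univ j)
    -- For the lower triangular `g * V`, a nonzero determinant means nonzero diagonal entries.
    have hdet : ((g : Matrix (Fin n) (Fin n) K) * V).det ≠ 0 := by
      rw [Matrix.det_mul, Matrix.det_of_isUpperTriangular hV]
      simpa [hV1] using (Matrix.GeneralLinearGroup.det_ne_zero g)
    rw [Matrix.det_of_isLowerTriangular _ fun i j h => hL i j h, Finset.prod_ne_zero_iff] at hdet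
    have := initialIdeal_map_linearSubst_of_lower τ hτ hL (fun i => hdet i (Finset.mem_univ i)) I
    rwa [map_linearSubst_mul, hI V hV hV1] at this

lemma inv_unitriangular {V : Matrix (Fin n) (Fin n) K} (hV : V.IsUpperTriangular)
    (hV1 : ∀ i, V i i = 1) :
    IsUnit V.det ∧ V⁻¹.IsUpperTriangular ∧ ∀ i, V⁻¹ i i = 1 := by
  have hdet : IsUnit V.det := by simp [Matrix.det_of_isUpperTriangular hV, hV1]
  have := V.invertibleOfIsUnitDet hdet
  have hinv : V⁻¹.IsUpperTriangular := Matrix.blockTriangular_inv_of_blockTriangular hV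
  refine ⟨hdet, hinv, fun i => ?_⟩
  have h := congrFun (congrFun (Matrix.mul_nonsing_inv V hdet) i) i
  rw [Matrix.mul_apply, Finset.sum_eq_single i, hV1, one_mul, Matrix.one_apply_eq] at h
  · exact h
  · intro k _ hk
    rcases hk.lt_or_gt with h | h
    · rw [hV h, zero_mul]
    · rw [hinv h, mul_zero]
  · simp

/-- An ideal that every upper unitriangular matrix maps into itself is fixed by these matrices. -/
lemma map_unitriangular_eq {I : Ideal (MvPolynomial (Fin n) K)}
    (hI : ∀ V : Matrix (Fin n) (Fin n) K, V.IsUpperTriangular → (∀ i, V i i = 1) →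
      I.map (linearSubst V) ≤ I)
    {V : Matrix (Fin n) (Fin n) K} (hV : V.IsUpperTriangular) (hV1 : ∀ i, V i i = 1) :
    I.map (linearSubst V) = I := by
  obtain ⟨hdet, hinv, hinv1⟩ := inv_unitriangular hV hV1
  refine le_antisymm (hI V hV hV1) fun f hf => ?_
  have h := Ideal.mem_map_of_mem (linearSubst V)
    (hI _ hinv hinv1 (Ideal.mem_map_of_mem (linearSubst V⁻¹) hf))
  rwa [← linearSubst_mul_apply, Matrix.mul_nonsing_inv V hdet, linearSubst_one_apply] at h

end Zariski

/-! ### The Borel order through partial sums. -/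

section Dominance

variable {n : ℕ}

/-- The sum of the first `k` entries of an exponent vector. -/
def partialSum (k : ℕ) (b : Fin n →₀ ℕ) : ℕ := ∑ i : Fin n with i.val < k, b i

lemma partialSum_add (k : ℕ) (a b : Fin n →₀ ℕ) :
    partialSum k (a + b) = partialSum k a + partialSum k b := by
  simp [partialSum, Finset.sum_add_distrib]

lemma partialSum_single (k : ℕ) (i : Fin n) :
    partialSum k (Finsupp.single i 1) = if i.val < k then 1 else 0 := by
  simp [partialSum, Finsupp.single_apply, Finset.sum_ite_eq]

lemma partialSum_zero (b : Fin n →₀ ℕ) : partialSum 0 b = 0 := by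
  simp [partialSum]

lemma partialSum_succ (i : Fin n) (b : Fin n →₀ ℕ) :
    partialSum (i.val + 1) b = partialSum i.val b + b i := by
  have : (Finset.univ.filter fun j : Fin n => j.val < i.val + 1) =
      insert i (Finset.univ.filter fun j : Fin n => j.val < i.val) := by
    ext j
    simp [Fin.ext_iff]
    omega
  rw [partialSum, this, Finset.sum_insert (by simp), add_comm]
  rfl

lemma partialSum_eq_degree {k : ℕ} {b : Fin n →₀ ℕ} (h : ∀ i : Fin n, k ≤ i.val → b i = 0) :
    partialSum k b = b.degree := by
  rw [Finsupp.degree_eq_sum, partialSum]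
  refine Finset.sum_filter_of_ne fun i _ hi => ?_
  by_contra hk
  exact hi (h i (not_lt.1 hk))

lemma partialSum_le_degree (k : ℕ) (b : Fin n →₀ ℕ) : partialSum k b ≤ b.degree := by
  rw [Finsupp.degree_eq_sum]
  exact Finset.sum_le_sum_of_subset (Finset.filter_subset _ _)

lemma eq_of_partialSum_eq {a b : Fin n →₀ ℕ} (h : ∀ k, partialSum k a = partialSum k b) :
    a = b := by
  ext i
  have h1 := partialSum_succ i a
  have h2 := partialSum_succ i b
  rw [h, h] at h1
  omega

/-- The dominance description of the Borel order. -/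
def Dominates (b c : Fin n →₀ ℕ) : Prop :=
  b.degree = c.degree ∧ ∀ k, partialSum k c ≤ partialSum k b

lemma Dominates.refl (b : Fin n →₀ ℕ) : Dominates b b := ⟨rfl, fun _ => le_rfl⟩

lemma Dominates.add {a a' b b' : Fin n →₀ ℕ} (h : Dominates a b) (h' : Dominates a' b') :
    Dominates (a + a') (b + b') :=
  ⟨by rw [map_add, map_add, h.1, h'.1], fun k => by
    rw [partialSum_add, partialSum_add]; exact add_le_add (h.2 k) (h'.2 k)⟩

lemma Dominates.single {i j : Fin n} (h : i ≤ j) :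
    Dominates (Finsupp.single i 1) (Finsupp.single j 1) := by
  refine ⟨by simp, fun k => ?_⟩
  have : i.val ≤ j.val := h
  rw [partialSum_single, partialSum_single]
  split_ifs <;> omega

/-- The inequalities between partial sums add up to equalities, so each is an equality. -/
lemma Dominates.eq_of_add_eq {a a' b b' : Fin n →₀ ℕ} (h : Dominates a b)
    (h' : Dominates a' b') (heq : a + a' = b + b') : a = b := by
  refine eq_of_partialSum_eq fun k => ?_
  have h1 := congrArg (partialSum k) heq
  rw [partialSum_add, partialSum_add] at h1
  have := h.2 k
  have := h'.2 k
  omega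

/-- Summation by parts: the coefficient of `e_j - e_{j+1}` is the difference of the `j`-th partial
sums. Dominance makes the truncated subtraction exact, and equal degrees make the last difference
vanish. -/
lemma Dominates.borelGE {b c : Fin n →₀ ℕ} (h : Dominates b c) : BorelGE b c := by
  refine ⟨fun j => partialSum (j.val + 1) b - partialSum (j.val + 1) c, ?_⟩
  have hD : ∀ k, ((partialSum k b - partialSum k c : ℕ) : ℤ) = partialSum k b - partialSum k c :=
    fun k => Nat.cast_sub (h.2 k)
  have hend : ∀ k, n ≤ k → ((partialSum k b : ℕ) : ℤ) = partialSum k c := fun k hk => by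
    rw [partialSum_eq_degree fun i hi => by omega, partialSum_eq_degree fun i hi => by omega, h.1]
  ext i
  simp only [toInt, Pi.sub_apply, Finset.sum_apply, smul_sub, Finset.sum_sub_distrib]
  simp only [Pi.smul_apply, Pi.single_apply, nsmul_eq_mul, hD, mul_ite, mul_one, mul_zero]
  have e1 : (∑ j : Fin (n - 1), if i = (⟨j.1, by omega⟩ : Fin n) then
      ((partialSum (j.val + 1) b : ℕ) : ℤ) - partialSum (j.val + 1) c else 0) =
      partialSum (i.val + 1) b - partialSum (i.val + 1) c := by
    by_cases hi : i.val < n - 1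
    · rw [Finset.sum_eq_single ⟨i.val, hi⟩]
      · simp
      · intro j _ hj
        rw [if_neg]
        rintro rfl
        exact hj rfl
      · simp
    · rw [hend _ (by omega), sub_self]
      refine Finset.sum_eq_zero fun j _ => if_neg ?_
      rintro rfl
      exact hi j.2
  have e2 : (∑ j : Fin (n - 1), if i = (⟨j.1 + 1, by omega⟩ : Fin n) then
      ((partialSum (j.val + 1) b : ℕ) : ℤ) - partialSum (j.val + 1) c else 0) =
      partialSum i.val b - partialSum i.val c := by
    by_cases hi : i.val = 0
    · rw [hi, partialSum_zero, partialSum_zero, sub_self]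
      refine Finset.sum_eq_zero fun j _ => if_neg fun hij => ?_
      have := congrArg Fin.val hij
      simp only at this
      omega
    · have hi' : i.val - 1 + 1 = i.val := by omega
      rw [Finset.sum_eq_single ⟨i.val - 1, by omega⟩]
      · simp [hi']
      · intro j _ hj
        refine if_neg fun hij => hj (Fin.ext ?_)
        have := congrArg Fin.val hij
        simp only at this ⊢
        omega
      · simp
  rw [e1, e2, partialSum_succ, partialSum_succ]
  push_cast
  ring

lemma IsBorelSet.mem_of_dominates {d : ℕ} {B : Set (Fin n →₀ ℕ)} (hB : IsBorelSet d B)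
    {b c : Fin n →₀ ℕ} (hc : c ∈ B) (h : Dominates b c) : b ∈ B :=
  hB.2 c (hB.1 hc) b (h.1.trans (hB.1 hc)) hc h.borelGE

/-- A vector that dominates the vector `s` supported in the indices up to `m`, and that is bounded
by `s` below `m`, equals `s`. -/
lemma Dominates.eq_of_le {b s : Fin n →₀ ℕ} {m : Fin n} (h : Dominates b s)
    (hs : ∀ i, m < i → s i = 0) (hle : ∀ i, i < m → b i ≤ s i) : b = s := by
  have hs' : partialSum (m.val + 1) s = s.degree :=
    partialSum_eq_degree fun i hi => hs i (Fin.lt_def.2 hi)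
  -- The indices up to `m` already carry the whole degree of `s`, hence that of `b`, so `b` vanishes
  -- beyond `m`.
  have hb' : partialSum (m.val + 1) b = b.degree :=
    le_antisymm (partialSum_le_degree _ _) (by rw [h.1, ← hs']; exact h.2 _)
  have hlow : ∀ i, i < m → b i = s i := by
    have hle' : ∀ i ∈ Finset.univ.filter fun i : Fin n => i.val < m.val, b i ≤ s i :=
      fun i hi => hle i (Fin.lt_def.2 (Finset.mem_filter.1 hi).2)
    have := (Finset.sum_eq_sum_iff_of_le hle').1
      (le_antisymm (Finset.sum_le_sum hle') (h.2 m.val))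
    exact fun i hi => this i (by simpa using hi)
  have hm : b m = s m := by
    have h1 := partialSum_succ m b
    have h2 := partialSum_succ m s
    have h3 : partialSum m.val b = partialSum m.val s :=
      Finset.sum_congr rfl fun i hi => hlow i (Fin.lt_def.2 (Finset.mem_filter.1 hi).2)
    have := h.1
    omega
  ext i
  rcases lt_trichotomy i m with hi | rfl | hi
  · exact hlow i hi
  · exact hm
  · rw [hs i hi]
    have h0 : ∑ j : Fin n with ¬ j.val < m.val + 1, b j = 0 := by
      have := Finset.sum_filter_add_sum_filter_not Finset.univ
        (fun j : Fin n => j.val < m.val + 1) (b ·)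
      rw [← Finsupp.degree_eq_sum] at this
      rw [partialSum] at hb'
      omega
    refine (Finset.sum_eq_zero_iff.1 h0) i ?_
    have : m.val < i.val := hi
    simp
    omega

end Dominance

/-! ### Upper triangular substitutions and supports. -/

section Upper

variable {n : ℕ} {K : Type*} [Field K]

lemma dominates_of_mem_support_linearSubst {V : Matrix (Fin n) (Fin n) K}
    (hV : V.IsUpperTriangular) (c : Fin n →₀ ℕ) :
    ∀ b ∈ (linearSubst V (monomial c 1)).support, Dominates b c := by
  classical
  induction c using exponent_induction with
  | zero =>
    intro b hb
    rw [show monomial 0 (1 : K) = 1 from rfl, map_one, support_one, Finset.mem_singleton] at hb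
    exact hb ▸ Dominates.refl _
  | add a a' ih ih' =>
    intro b hb
    rw [monomial_one_add, map_mul] at hb
    obtain ⟨x, hx, y, hy, rfl⟩ := Finset.mem_add.1 (support_mul _ _ hb)
    exact (ih x hx).add (ih' y hy)
  | single j =>
    intro b hb
    rw [show monomial (Finsupp.single j 1) (1 : K) = X j from rfl, linearSubst_X, mem_support_iff,
      coeff_sum_C_mul_X] at hb
    obtain ⟨i, -, hi⟩ := Finset.exists_ne_zero_of_sum_ne_zero hb
    rw [ne_eq, ite_eq_right_iff, Classical.not_imp] at hi
    obtain ⟨rfl, hi⟩ := hi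
    exact Dominates.single (not_lt.1 fun h => hi (hV h))

/-- The coefficient of `X^c` in its own image is `1`: by `Dominates.eq_of_add_eq`, in a product it
arises only from the two diagonal terms. -/
lemma dominates_of_mem_support_linearSubst_sub {V : Matrix (Fin n) (Fin n) K}
    (hV : V.IsUpperTriangular) (hV1 : ∀ i, V i i = 1) (c : Fin n →₀ ℕ) :
    ∀ b ∈ (linearSubst V (monomial c 1) - monomial c 1).support, Dominates b c ∧ b ≠ c := by
  classical
  intro b hb
  refine ⟨?_, ?_⟩
  · rcases Finset.mem_union.1 (support_sub _ _ _ hb) with h | h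
    · exact dominates_of_mem_support_linearSubst hV c b h
    · rw [Finset.mem_singleton.1 (support_monomial_subset h)]
      exact Dominates.refl _
  · rintro rfl
    rw [mem_support_iff, coeff_sub, coeff_monomial, if_pos rfl, sub_ne_zero] at hb
    refine hb ?_
    clear hb
    induction b using exponent_induction with
    | zero => rw [show monomial 0 (1 : K) = 1 from rfl, map_one, coeff_zero_one]
    | add a a' ih ih' =>
      rw [monomial_one_add, map_mul, coeff_mul, Finset.sum_eq_single (a, a'), ih, ih', one_mul]
      · rintro ⟨x, y⟩ hxy hne
        replace hxy : x + y = a + a' :=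
          Finset.HasAntidiagonal.mem_antidiagonal.1 hxy
        by_contra h
        have hx := dominates_of_mem_support_linearSubst hV a x
          (mem_support_iff.2 (left_ne_zero_of_mul h))
        have hy := dominates_of_mem_support_linearSubst hV a' y
          (mem_support_iff.2 (right_ne_zero_of_mul h))
        obtain rfl : x = a := hx.eq_of_add_eq hy hxy
        exact hne (by rw [add_left_cancel hxy])
      · simp
    | single j =>
      rw [show monomial (Finsupp.single j 1) (1 : K) = X j from rfl, linearSubst_X,
        coeff_sum_C_mul_X]
      simp [Finsupp.single_left_inj, hV1]

lemma mem_of_forall_monomial_mem {I : Ideal (MvPolynomial (Fin n) K)} {f : MvPolynomial (Fin n) K}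
    (h : ∀ b ∈ f.support, monomial b 1 ∈ I) : f ∈ I := by
  rw [f.as_sum]
  refine Ideal.sum_mem _ fun b hb => ?_
  rw [← mul_one (coeff b f), ← C_mul_monomial]
  exact Ideal.mul_mem_left _ _ (h b hb)

end Upper

/-! ### Invariance of the ideal of a good binomial system. -/

section BinomialSystem

variable {n : ℕ} {d : ℕ} {A C : Set (Fin n →₀ ℕ)} {ρ : Fin n → ℤ}

lemma toInt_injective : Function.Injective (toInt (n := n)) := fun a b h => by
  ext i
  exact Nat.cast_injective (R := ℤ) (congrFun h i)

lemma toInt_add (a b : Fin n →₀ ℕ) : toInt (a + b) = toInt a + toInt b := by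
  ext i
  simp [toInt]

lemma eq_zero_of_maxIndex_lt [NeZero n] {i : Fin n} (h : maxIndex ρ < i) : ρ i = 0 := by
  by_contra hi
  exact h.not_ge (Finset.le_max' _ _ (by simp [hi]))

/-- Such a `b` lies in both Borel sets, which meet only in `A` because `C` and `C + ρ` are disjoint.
-/
lemma IsBinomialSystem.mem_left_of_dominates (h : IsBinomialSystem d A C ρ) {a b : Fin n →₀ ℕ}
    (ha : a ∈ A) (hb : Dominates b a) : b ∈ A := by
  rcases h.borel_union.mem_of_dominates (Or.inl ha) hb with h1 | h1
  · exact h1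
  · rcases h.borel_union_translate.mem_of_dominates (Or.inl ha) hb with h2 | h2
    · exact h2
    · exact absurd (show b ∈ C ∩ translateSet C ρ from ⟨h1, h2⟩) (by simp [h.right_inter_translate])

/-- Moving up strictly in the indices up to `m` leads from `T` into `A`, if the elements of `T`
agree below `m`. -/
lemma mem_left_of_strictly_dominates {T : Set (Fin n →₀ ℕ)} (hB : IsBorelSet d (A ∪ T)) {m : Fin n}
    {c : Fin n →₀ ℕ} (hc : c ∈ T) (hT : ∀ b ∈ T, ∀ i, i < m → b i = c i) {x y : Fin n →₀ ℕ}
    (hx : Dominates x (c.filter (· ≤ m))) (hne : x ≠ c.filter (· ≤ m))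
    (hy : Dominates y (c.filter (¬ · ≤ m))) : x + y ∈ A := by
  have hxy : x + y ∈ A ∪ T := hB.mem_of_dominates (Or.inr hc) (by
    simpa only [Finsupp.filter_add_filter_not] using hx.add hy)
  rcases hxy with h | h
  · exact h
  -- If `x + y` were in `T`, it would agree with `c` below `m`, bounding `x` there by the head of
  -- `c`; dominance then forces `x` to be that head.
  · refine absurd (hx.eq_of_le (m := m) (fun i hi => ?_) fun i hi => ?_) hne
    · exact Finsupp.filter_apply_neg _ _ hi.not_ge
    · rw [Finsupp.filter_apply_pos (· ≤ m) _ hi.le, ← hT _ h i hi, Finsupp.add_apply]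
      exact Nat.le_add_right _ _

variable {K : Type*} [Field K]

lemma monomial_mem_binomialIdeal {a : Fin n →₀ ℕ} (ha : a ∈ A) :
    monomial a 1 ∈ binomialIdeal K A C ρ :=
  Ideal.subset_span (Or.inl ⟨a, ha, rfl⟩)

/-- Stated for a general `T` so as to serve both `T = C` and `T = C + ρ`. -/
lemma strict_part_mem {T : Set (Fin n →₀ ℕ)} (hB : IsBorelSet d (A ∪ T)) {m : Fin n}
    {c : Fin n →₀ ℕ} (hc : c ∈ T) (hT : ∀ b ∈ T, ∀ i, i < m → b i = c i)
    {V : Matrix (Fin n) (Fin n) K} (hV : V.IsUpperTriangular) (hV1 : ∀ i, V i i = 1) :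
    (linearSubst V (monomial (c.filter (· ≤ m)) 1) - monomial (c.filter (· ≤ m)) 1) *
      linearSubst V (monomial (c.filter (¬ · ≤ m)) 1) ∈ binomialIdeal K A C ρ := by
  classical
  refine mem_of_forall_monomial_mem fun b hb => ?_
  obtain ⟨x, hx, y, hy, rfl⟩ := Finset.mem_add.1 (support_mul _ _ hb)
  obtain ⟨hx, hne⟩ := dominates_of_mem_support_linearSubst_sub hV hV1 _ x hx
  exact monomial_mem_binomialIdeal (mem_left_of_strictly_dominates hB hc hT hx hne
    (dominates_of_mem_support_linearSubst hV _ y hy))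

/-- Either `a ∈ C` and the difference is a generator, or neither `a ∈ C` nor `b ∈ C + ρ`, and both
exponents lie in `A`. -/
lemma monomial_sub_mem_binomialIdeal {a b : Fin n →₀ ℕ}
    (ha : a ∈ A ∪ C) (hb : b ∈ A ∪ translateSet C ρ) (hab : toInt b = toInt a + ρ) :
    monomial a 1 - monomial b 1 ∈ binomialIdeal K A C ρ := by
  by_cases haC : a ∈ C
  · exact Ideal.subset_span (Or.inr ⟨a, haC, b, hab, rfl⟩)
  · refine Ideal.sub_mem _ (monomial_mem_binomialIdeal (ha.resolve_right haC))
      (monomial_mem_binomialIdeal (hb.resolve_right ?_))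
    rintro ⟨c, hc, hbc⟩
    rw [hab, add_left_inj] at hbc
    exact haC (toInt_injective hbc ▸ hc)

lemma IsGoodBinomialSystem.linearSubst_binomial_mem [NeZero n] (h : IsGoodBinomialSystem d A C ρ)
    {V : Matrix (Fin n) (Fin n) K} (hV : V.IsUpperTriangular) (hV1 : ∀ i, V i i = 1)
    {c e : Fin n →₀ ℕ} (hc : c ∈ C) (hce : toInt e = toInt c + ρ) :
    linearSubst V (monomial c 1 - monomial e 1) ∈ binomialIdeal K A C ρ := by
  classical
  obtain ⟨hs, hgood⟩ := h
  set m := maxIndex ρ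
  have he : e ∈ translateSet C ρ := ⟨c, hc, hce⟩
  have happly : ∀ i, (e i : ℤ) = c i + ρ i := fun i => congrFun hce i
  have hT : ∀ b ∈ translateSet C ρ, ∀ i, i < m → b i = e i := by
    rintro b ⟨c', hc', hb⟩ i hi
    have h1 : (b i : ℤ) = c' i + ρ i := congrFun hb i
    have h2 := happly i
    have h3 := hgood c' hc' c hc i hi
    omega
  -- `ρ` vanishes beyond `m`, so `c` and `e` share their tail.
  have htail : e.filter (¬ · ≤ m) = c.filter (¬ · ≤ m) := by
    ext i
    by_cases hi : i ≤ m
    · simp [hi]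
    · have h1 := happly i
      rw [eq_zero_of_maxIndex_lt (not_le.1 hi), add_zero] at h1
      rw [Finsupp.filter_apply_pos (¬ · ≤ m) _ hi,
        Finsupp.filter_apply_pos (¬ · ≤ m) _ hi]
      exact_mod_cast h1
  set s := c.filter (· ≤ m)
  set s' := e.filter (· ≤ m)
  set t := c.filter (¬ · ≤ m)
  have hcst : s + t = c := Finsupp.filter_add_filter_not c _
  have hest : s' + t = e := by
    rw [← htail]
    exact Finsupp.filter_add_filter_not e _
  have hss : toInt s' = toInt s + ρ := by
    have h1 := hce
    rw [← hcst, ← hest, toInt_add, toInt_add] at h1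
    rw [add_right_comm] at h1
    exact add_right_cancel h1
  -- The first summand moves only the tail; the other two collect the strict movement of each head.
  have hexp : linearSubst V (monomial c 1 - monomial e 1) =
      (monomial s 1 - monomial s' 1) * linearSubst V (monomial t 1) +
      (linearSubst V (monomial s 1) - monomial s 1) * linearSubst V (monomial t 1) -
      (linearSubst V (monomial s' 1) - monomial s' 1) * linearSubst V (monomial t 1) := by
    rw [← hcst, ← hest, monomial_one_add, monomial_one_add, map_sub, map_mul, map_mul]
    ring
  rw [hexp]
  refine Ideal.sub_mem _ (Ideal.add_mem _ ?_ ?_) ?_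
  · rw [(linearSubst V (monomial t 1)).as_sum, Finset.mul_sum]
    refine Ideal.sum_mem _ fun b hb => ?_
    have hdom := dominates_of_mem_support_linearSubst hV t b hb
    rw [← mul_one (coeff b _), ← C_mul_monomial, mul_left_comm, sub_mul, ← monomial_one_add,
      ← monomial_one_add]
    refine Ideal.mul_mem_left _ _ (monomial_sub_mem_binomialIdeal ?_ ?_ ?_)
    · exact hs.borel_union.mem_of_dominates (Or.inr hc) (hcst ▸ (Dominates.refl s).add hdom)
    · exact hs.borel_union_translate.mem_of_dominates (Or.inr he)
        (hest ▸ (Dominates.refl s').add hdom)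
    · rw [toInt_add, toInt_add, hss, add_right_comm]
  · exact strict_part_mem hs.borel_union hc (fun b hb i hi => hgood b hb c hc i hi) hV hV1
  · have := strict_part_mem (K := K) (C := C) (ρ := ρ) hs.borel_union_translate he hT hV hV1
    rwa [htail] at this

/-- The ideal of a good binomial system is mapped into itself by upper unitriangular matrices. -/
lemma IsGoodBinomialSystem.map_binomialIdeal_le [NeZero n] (h : IsGoodBinomialSystem d A C ρ)
    (V : Matrix (Fin n) (Fin n) K) (hV : V.IsUpperTriangular) (hV1 : ∀ i, V i i = 1) :
    (binomialIdeal K A C ρ).map (linearSubst V) ≤ binomialIdeal K A C ρ := by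
  rw [Ideal.map_le_iff_le_comap]
  refine Ideal.span_le.2 ?_
  rintro _ (⟨a, ha, rfl⟩ | ⟨c, hc, e, he, rfl⟩)
  · exact mem_of_forall_monomial_mem (f := linearSubst V _) fun b hb => monomial_mem_binomialIdeal
      (h.1.mem_left_of_dominates ha (dominates_of_mem_support_linearSubst hV a b hb))
  · exact h.linearSubst_binomial_mem hV hV1 hc he

end BinomialSystem

end BinomialGin

theorem mainTheorem7 {K : Type*} [Field K] [CharZero K] {n d : ℕ} [NeZero n] (hd : 0 < d)
    (A C : Set (Fin n →₀ ℕ)) (ρ : Fin n → ℤ)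
    (hgood : BinomialGin.IsGoodBinomialSystem d A C ρ)
    (τ : MonomialOrder (Fin n)) (hτ : BinomialGin.IsAdmissible τ) :
    (∃! 𝔟, BinomialGin.IsGenericInitialIdeal τ (BinomialGin.binomialIdeal K A C ρ) 𝔟) ∧
      BinomialGin.gin τ (BinomialGin.binomialIdeal K A C ρ) =
        BinomialGin.initialIdeal τ (BinomialGin.binomialIdeal K A C ρ) := by
  have hgin := BinomialGin.isGenericInitialIdeal_of_unitriangular_fixed (K := K) hτ
    fun V hV hV1 => BinomialGin.map_unitriangular_eq hgood.map_binomialIdeal_le hV hV1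
  have hex : ∃ 𝔟, BinomialGin.IsGenericInitialIdeal τ (BinomialGin.binomialIdeal K A C ρ) 𝔟 :=
    ⟨_, hgin⟩
  refine ⟨⟨_, hgin, fun 𝔟 h => h.unique hgin⟩, ?_⟩
  rw [BinomialGin.gin, dif_pos hex]
  exact hex.choose_spec.unique hgin
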